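/- Consider a star DC network with source voltage $E>0$, line conductance $g_l>0$, and a finite set of loads $N=F\sqcup I$, where $F\neq\emptyset$ is the set of flexible loads and $I$ the (possibly empty) set of inflexible loads. The nominal demands satisfy $P_{0,i}\ge 0$ for $i\in F$ and $P_{0,i}>0$ for $i\in I$. For $g\in\mathbb{R}^N$ put $\bar g=\sum_{i\in N}g_i$, $v(\bar g)=\frac{E g_l}{\bar g+g_l}$, $P_i(g)=v(\bar g)^2g_i$, $\Delta P_i(g)=P_i(g)-P_{0,i}$, $\bar P_0=\sum_{i\in N}P_{0,i}$, $\overline{\Delta P}(\bar g)=\frac{(E g_l)^2}{(\bar g+g_l)^2}\,\bar g-\bar P_0$ and $P_{\max}=\frac{E^2g_l}{4}$. Let $\kappa_i>0$ for $i\in F$, $\bar\kappa=\sum_{i\in F}\kappa_i$, and $a,b>0$. The closed-loop system with the VCS controller, with state $(g,\phi,\hat g)\in\mathbb{R}^N\times\mathbb{R}\times\mathbb{R}^F$, is $$\dot g_i=-\Delta P_i(g)-\kappa_i\phi+b(\hat g_i-g_i)\ (i\in F),\qquad \dot g_i=-\Delta P_i(g)\ (i\in I),$$ $$\dot\phi=\overline{\Delta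 P}(\bar g)\,\frac{d\,\overline{\Delta P}}{d\bar g}(\bar g),\qquad \dot{\hat g}_i=-a(\hat g_i-g_i)\ (i\in F).$$ Let $\mathcal E_s$ (load satisfaction) be the set of $(g,\phi,\hat g)$ with $g\ge 0$, $\Delta P_i(g)=0$ for all $i\in N$, $\phi=0$ and $\hat g_i=g_i$ for $i\in F$. Let $\mathcal E_p$ (proportional allocation) be the set of $(g,\phi,\hat g)$ with $g\ge0$, $\Delta P_i(g)=\frac{\kappa_i}{\bar\kappa}(P_{\max}-\bar P_0)$ for $i\in F$, $\Delta P_i(g)=0$ for $i\in I$, $\phi=\frac{\bar P_0-P_{\max}}{\bar\kappa}$ and $\hat g_i=g_i$ for $i\in F$. Let $M=\{g\in\mathbb{R}^N: g\ge 0,\ \bar g<g_l\}$. Fix the network, the $\kappa_i$ and $b>0$. Then there is $a_0>0$ such that for every $a\in(0,a_0)$: 1. If $\bar P_0>P_{\max}$ and the flexible demand suffices for the required load shedding, i.e. $\frac{\kappa_i}{\bar\kappa}(\bar P_0-P_{\max})\le P_{0,i}$ for all $i\in F$ (equivalently, $\mathcal E_p\neq\emptyset$), then $\mathcal E_p$ consists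 of exactly one point, this point is the only equilibrium of the closed-loop system with $g\ge 0$, and it is locally asymptotically stable. 2. If $\bar P_0<P_{\max}$, then there is exactly one point $(g^*,\phi^*,\hat g^*)\in\mathcal E_s$ with $g^*\in\mathrm{cl}(M)$; it satisfies $g^*\in M$, i.e. $g^*\geq 0$ and $\sum_{i\in N} g^*_i<g_l$, and it is a locally asymptotically stable equilibrium of the closed-loop system. -/

import Mathlib

open Set Filter Topology

noncomputable section

namespace StarDC

/-- `x` is a solution on `[0, ∞)` of the autonomous differential equation `x' = f(x)`. -/
def IsForwardSolution {X : Type*} [NormedAddCommGroup X] [NormedSpace ℝ X]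
    (f : X → X) (x : ℝ → X) : Prop :=
  ∀ t : ℝ, 0 ≤ t → HasDerivWithinAt x (f (x t)) (Ici 0) t

/-- `p` is a locally asymptotically stable equilibrium of `x' = f(x)`: it is an equilibrium;
it is Lyapunov stable (all initial states close to `p` admit a solution on `[0, ∞)`, and all such
solutions stay close to `p`); and all solutions that start close enough to `p` converge to `p`. -/
def IsLocallyAsymptoticallyStable {X : Type*} [NormedAddCommGroup X] [NormedSpace ℝ X]
    (f : X → X) (p : X) : Prop :=
  f p = 0 ∧
  (∀ ε : ℝ, 0 < ε → ∃ δ : ℝ, 0 < δ ∧ ∀ x₀ : X, dist x₀ p < δ →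
    (∃ x : ℝ → X, x 0 = x₀ ∧ IsForwardSolution f x) ∧
    ∀ x : ℝ → X, x 0 = x₀ → IsForwardSolution f x → ∀ t : ℝ, 0 ≤ t → dist (x t) p < ε) ∧
  (∃ δ : ℝ, 0 < δ ∧ ∀ x : ℝ → X, dist (x 0) p < δ → IsForwardSolution f x →
    Tendsto x atTop (𝓝 p))

/-- The data of a star DC network with a finite set `F` of flexible loads and a finite set `I` of
inflexible loads; the set of all loads is the disjoint union `F ⊕ I`. -/
structure StarNetwork (F I : Type*) where
  /-- source voltage -/
  E : ℝ
  /-- conductance of the transmission line -/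
  gl : ℝ
  /-- nominal demand of each load -/
  P0 : F ⊕ I → ℝ
  /-- load shedding parameter of each flexible load -/
  κ : F → ℝ

/-- States `(g, φ, ĝ)`: the conductances of all loads, the shared state, and one auxiliary state
per flexible load. -/
abbrev State (F I : Type*) := (F ⊕ I → ℝ) × ℝ × (F → ℝ)

namespace StarNetwork

variable {F I : Type*} [Fintype F] [Fintype I] (S : StarNetwork F I)

/-- The total conductance `∑ i, g i`. -/
def totalConductance (g : F ⊕ I → ℝ) : ℝ := ∑ i, g i

/-- The load voltage `v = E g_l / (ḡ + g_l)` as a function of the total conductance. -/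
def voltage (gbar : ℝ) : ℝ := S.E * S.gl / (gbar + S.gl)

/-- The power `P_i(g) = v² g_i` consumed by load `i`. -/
def power (g : F ⊕ I → ℝ) (i : F ⊕ I) : ℝ := S.voltage (totalConductance g) ^ 2 * g i

/-- `ΔP_i(g) = P_i(g) - P_{0,i}`. -/
def deltaP (g : F ⊕ I → ℝ) (i : F ⊕ I) : ℝ := S.power g i - S.P0 i

/-- The total consumed power as a function of the total conductance. -/
def totalPower (gbar : ℝ) : ℝ := (S.E * S.gl) ^ 2 / (gbar + S.gl) ^ 2 * gbar

theorem sum_power (g : F ⊕ I → ℝ) : ∑ i, S.power g i = S.totalPower (totalConductance g) := by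
  simp only [power, totalPower, ← Finset.mul_sum, voltage, div_pow]
  rfl

/-- The total demand. -/
def totalDemand : ℝ := ∑ i, S.P0 i

/-- The difference between total consumed power and total demand, as a function of the total
conductance. -/
def totalDeltaP (gbar : ℝ) : ℝ := S.totalPower gbar - S.totalDemand

/-- The network capacity `P_max = E² g_l / 4`. -/
def Pmax : ℝ := S.E ^ 2 * S.gl / 4

/-- The sum of the load shedding parameters. -/
def κbar : ℝ := ∑ i, S.κ i

/-- The right-hand side of the closed-loop dynamics with the VCS controller. -/
def vcsField (a b : ℝ) : State F I → State F I := fun x =>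
  (Sum.elim
    (fun i => -S.deltaP x.1 (Sum.inl i) - S.κ i * x.2.1 + b * (x.2.2 i - x.1 (Sum.inl i)))
    (fun j => -S.deltaP x.1 (Sum.inr j)),
   S.totalDeltaP (totalConductance x.1) * deriv S.totalDeltaP (totalConductance x.1),
   fun i => -a * (x.2.2 i - x.1 (Sum.inl i)))

/-- The equilibria of the closed loop with nonnegative conductances. -/
def equilibria (a b : ℝ) : Set (State F I) :=
  {x | (∀ i, 0 ≤ x.1 i) ∧ S.vcsField a b x = 0}

/-- The load satisfaction set. -/
def loadSatisfaction : Set (State F I) :=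
  {x | (∀ i, 0 ≤ x.1 i) ∧ (∀ i, S.deltaP x.1 i = 0) ∧ x.2.1 = 0 ∧
    ∀ i, x.2.2 i = x.1 (Sum.inl i)}

/-- The proportional allocation set. -/
def proportionalAllocation : Set (State F I) :=
  {x | (∀ i, 0 ≤ x.1 i) ∧
    (∀ i, S.deltaP x.1 (Sum.inl i) = S.κ i / S.κbar * (S.Pmax - S.totalDemand)) ∧
    (∀ j, S.deltaP x.1 (Sum.inr j) = 0) ∧
    x.2.1 = (S.totalDemand - S.Pmax) / S.κbar ∧
    ∀ i, x.2.2 i = x.1 (Sum.inl i)}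

/-- The conductance vectors `g ≥ 0` with total conductance below `g_l`. -/
def regionM : Set (F ⊕ I → ℝ) := {g | (∀ i, 0 ≤ g i) ∧ totalConductance g < S.gl}

end StarNetwork

end StarDC

end

/-
Stability follows from Lyapunov's indirect method, so the point is a quadratic Lyapunov function of
the linearization. There the total flexible conductance `x`, the total inflexible conductance `z`,
the sum `U` of the filter states and the shifted shared state `η = κ̄ φ - b U` evolve autonomously,
and they drive the individual loads, which are otherwise decoupled: the linearization is a cascade.
For small `a` the aggregates in turn split into a fast part `(x, z, η)` and a slow part `U`, which
is pulled towards `x`; since `x = 0` at the fast equilibrium, the slow part decays as well. Each of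
these compositions of Lyapunov forms comes down to Finsler's lemma: a form that is positive
semidefinite becomes positive definite after adding a small multiple of a form that is positive on
its null directions.

The equilibria are read off the power curve `s ↦ (E g_l)² s / (s + g_l)²`, which increases on
`[0, g_l]` and attains its maximum `P_max` over `s ≥ 0` only at `g_l`. The total conductance of an
equilibrium is hence `g_l` under overload, and below `g_l` when the demand is feasible.
-/

noncomputable section

namespace StarDC

section QuadraticForms

open QuadraticMap

variable {X : Type*} [NormedAddCommGroup X] [NormedSpace ℝ X] [FiniteDimensional ℝ X]

theorem continuous_quadraticForm (Q : QuadraticForm ℝ X) : Continuous Q := by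
  have hQ (x : X) : Q x = 2⁻¹ * LinearMap.toContinuousBilinearMap Q.polarBilin x x := by
    simp [polar_self]
  rw [funext hQ]
  fun_prop

theorem hasDerivWithinAt_quadraticForm (Q : QuadraticForm ℝ X) {x : ℝ → X} {x' : X} {s : Set ℝ}
    {t : ℝ} (hx : HasDerivWithinAt x x' s t) :
    HasDerivWithinAt (fun t => Q (x t)) (polar Q (x t) x') s t := by
  set B := LinearMap.toContinuousBilinearMap Q.polarBilin
  have hQ (y : X) : Q y = 2⁻¹ * B y y := by simp [B, polar_self]
  simp only [hQ]
  refine (((B.hasFDerivAt.comp_hasDerivWithinAt t hx).clm_apply hx).const_mul 2⁻¹).congr_deriv ?_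
  simp only [B, Function.comp_apply, LinearMap.toContinuousBilinearMap_apply,
    polarBilin_apply_apply, polar_comm Q x']
  ring

theorem exists_mul_norm_sq_le {Q : QuadraticForm ℝ X} (hQ : Q.PosDef) :
    ∃ m > 0, ∀ x, m * ‖x‖ ^ 2 ≤ Q x := by
  have hsphere : ∀ u ∈ Metric.sphere (0 : X) 1, 0 < Q u :=
    fun u hu => hQ u (ne_zero_of_mem_unit_sphere ⟨u, hu⟩)
  obtain ⟨m, hm, hmQ⟩ := (isCompact_sphere (0 : X) 1).exists_forall_le'
    (continuous_quadraticForm Q).continuousOn hsphere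
  refine ⟨m, hm, fun x => ?_⟩
  obtain rfl | hx := eq_or_ne x 0
  · simp
  · have hu := hmQ (‖x‖⁻¹ • x) (by simp [norm_smul, hx])
    rw [QuadraticMap.map_smul, smul_eq_mul] at hu
    field_simp at hu
    exact hu

/- Finsler's lemma: near the zeros of `P` on the unit sphere `R` is positive, and away from them a
small multiple of `R` cannot outweigh `P`. -/
theorem eventually_posDef_add_smul {P R : QuadraticForm ℝ X} (hP : ∀ x, 0 ≤ P x)
    (hR : ∀ x, x ≠ 0 → P x = 0 → 0 < R x) : ∀ᶠ ε in 𝓝[>] (0 : ℝ), (P + ε • R).PosDef := by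
  have hcont : Continuous fun z : ℝ × X => P z.2 + z.1 * R z.2 := by
    have := continuous_quadraticForm P
    have := continuous_quadraticForm R
    fun_prop
  have hlocal : ∀ u ∈ Metric.sphere (0 : X) 1,
      ∀ᶠ z : ℝ × X in 𝓝 (0, u), 0 < z.1 → 0 < P z.2 + z.1 * R z.2 := by
    intro u hu
    have hu0 : u ≠ 0 := ne_zero_of_mem_unit_sphere ⟨u, hu⟩
    obtain hPu | hPu := (hP u).eq_or_lt
    · have hpos : ∀ᶠ z : ℝ × X in 𝓝 (0, u), 0 < R z.2 :=
        ((continuous_quadraticForm R).comp continuous_snd).continuousAt.eventually_const_lt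
          (hR u hu0 hPu.symm)
      filter_upwards [hpos] with z hz hε
      exact add_pos_of_nonneg_of_pos (hP z.2) (mul_pos hε hz)
    · have hpos : ∀ᶠ z : ℝ × X in 𝓝 (0, u), 0 < P z.2 + z.1 * R z.2 :=
        hcont.continuousAt.eventually_const_lt (by simpa using hPu)
      exact hpos.mono fun _ hz _ => hz
  have hsphere := (isCompact_sphere (0 : X) 1).eventually_forall_of_forall_eventually
    (P := fun ε u => 0 < ε → 0 < P u + ε * R u) hlocal
  filter_upwards [nhdsWithin_le_nhds hsphere, self_mem_nhdsWithin] with ε hε hε0 x hx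
  have hu := hε (‖x‖⁻¹ • x) (by simp [norm_smul, hx]) hε0
  have hscale : P (‖x‖⁻¹ • x) + ε * R (‖x‖⁻¹ • x) = ‖x‖⁻¹ * ‖x‖⁻¹ * (P + ε • R) x := by
    simp only [QuadraticMap.map_smul, add_apply, smul_apply, smul_eq_mul]
    ring
  rw [hscale] at hu
  exact pos_of_mul_pos_right hu (by positivity)

end QuadraticForms

section LyapunovForms

open QuadraticMap

variable {X Y : Type*} [NormedAddCommGroup X] [NormedSpace ℝ X]
  [NormedAddCommGroup Y] [NormedSpace ℝ Y]

/-- The rate `-d/dt Q(x)` at which the quadratic form `Q` is dissipated along the linear flow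
`x' = A x`, as a quadratic form in `x`. -/
def dissipation (Q : QuadraticForm ℝ X) (A : X →L[ℝ] X) : QuadraticForm ℝ X :=
  LinearMap.BilinMap.toQuadraticMap (-Q.polarBilin.compl₂ (A : X →ₗ[ℝ] X))

@[simp]
theorem dissipation_apply (Q : QuadraticForm ℝ X) (A : X →L[ℝ] X) (x : X) :
    dissipation Q A x = -polar Q x (A x) := rfl

theorem dissipation_add_smul (Q N : QuadraticForm ℝ X) (ε : ℝ) (A : X →L[ℝ] X) :
    dissipation (Q + ε • N) A = dissipation Q A + ε • dissipation N A := by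
  ext x
  simp only [dissipation_apply, FunLike.coe_add, FunLike.coe_smul, polar_add, polar_smul, add_apply,
    smul_apply, smul_eq_mul]
  ring

/-- The linear flow `x' = A x` has a quadratic Lyapunov function: a positive definite form whose
dissipation is positive definite. -/
def HasLyapunovForm (A : X →L[ℝ] X) : Prop :=
  ∃ Q : QuadraticForm ℝ X, Q.PosDef ∧ (dissipation Q A).PosDef

namespace HasLyapunovForm

theorem of_injective {A : X →L[ℝ] X} {A' : Y →L[ℝ] Y} (h : HasLyapunovForm A') {J : X →L[ℝ] Y}
    (hJ : Function.Injective J) (hcomm : ∀ x, J (A x) = A' (J x)) : HasLyapunovForm A := by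
  obtain ⟨Q, hQ, hdis⟩ := h
  have hJ0 (x : X) (hx : x ≠ 0) : J x ≠ 0 := (map_ne_zero_iff J hJ).2 hx
  refine ⟨Q.comp (J : X →ₗ[ℝ] Y), fun x hx => hQ _ (hJ0 x hx), fun x hx => ?_⟩
  have hpos := hdis _ (hJ0 x hx)
  simpa [polar, hcomm] using hpos

theorem pi {ι : Type*} [Fintype ι] {E : ι → Type*} [∀ i, NormedAddCommGroup (E i)]
    [∀ i, NormedSpace ℝ (E i)] {A : ∀ i, E i →L[ℝ] E i} (h : ∀ i, HasLyapunovForm (A i)) :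
    HasLyapunovForm (ContinuousLinearMap.piMap A) := by
  choose Q hQ hdis using h
  refine ⟨QuadraticMap.pi Q, posDef_pi_iff.2 hQ, ?_⟩
  have hpi : dissipation (QuadraticMap.pi Q) (ContinuousLinearMap.piMap A) =
      QuadraticMap.pi fun i => dissipation (Q i) (A i) := by
    ext x
    simp [QuadraticMap.pi_apply]
  exact hpi ▸ posDef_pi_iff.2 hdis

theorem of_semidefinite [FiniteDimensional ℝ X] {A : X →L[ℝ] X} {Q N : QuadraticForm ℝ X}
    (hQ : Q.PosDef) (hdis : ∀ x, 0 ≤ dissipation Q A x)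
    (hN : ∀ x, x ≠ 0 → dissipation Q A x = 0 → 0 < dissipation N A x) : HasLyapunovForm A := by
  have hpos : ∀ᶠ ε in 𝓝[>] (0 : ℝ), (Q + ε • N).PosDef :=
    eventually_posDef_add_smul hQ.nonneg fun x hx h0 => absurd h0 (hQ x hx).ne'
  obtain ⟨ε, hε, hε'⟩ := (hpos.and (eventually_posDef_add_smul hdis hN)).exists
  exact ⟨Q + ε • N, hε, dissipation_add_smul Q N ε A ▸ hε'⟩

variable [FiniteDimensional ℝ X] [FiniteDimensional ℝ Y]

theorem cascade {A : X →L[ℝ] X} {D : Y →L[ℝ] Y} (hA : HasLyapunovForm A) (hD : HasLyapunovForm D)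
    (C : X →L[ℝ] Y) :
    HasLyapunovForm ((A.comp (.fst ℝ X Y)).prod (C.comp (.fst ℝ X Y) + D.comp (.snd ℝ X Y))) := by
  obtain ⟨Q, hQ, hQdis⟩ := hA
  obtain ⟨R, hR, hRdis⟩ := hD
  set M := (A.comp (.fst ℝ X Y)).prod (C.comp (.fst ℝ X Y) + D.comp (.snd ℝ X Y))
  have hdisX (z : X × Y) : dissipation (Q.comp (.fst ℝ X Y)) M z = dissipation Q A z.1 := rfl
  have hdisY (z : X × Y) (hz : z.1 = 0) : dissipation (Q.prod R) M z = dissipation R D z.2 := by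
    simp [M, QuadraticMap.polar_prod, hz]
  have hdis := eventually_posDef_add_smul (P := dissipation (Q.comp (.fst ℝ X Y)) M)
    (R := dissipation (Q.prod R) M) (fun z => hdisX z ▸ hQdis.nonneg z.1) fun z hz h0 => by
      have hz1 : z.1 = 0 := hQdis.anisotropic _ (hdisX z ▸ h0)
      have hz2 : z.2 ≠ 0 := fun hz2 => hz (Prod.ext hz1 hz2)
      exact hdisY z hz1 ▸ hRdis _ hz2
  obtain ⟨ε, hε, (hεpos : 0 < ε)⟩ := (hdis.and self_mem_nhdsWithin).exists
  refine ⟨Q.comp (.fst ℝ X Y) + ε • Q.prod R, fun z hz => ?_, ?_⟩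
  · exact add_pos_of_nonneg_of_pos (hQ.nonneg z.1) (mul_pos hεpos (hQ.prod hR z hz))
  · exact dissipation_add_smul (X := X × Y) .. ▸ hε

/- Two time scales: to leading order in `a` the form `Q_A(x) + Q_D(u)` dissipates `Q_A` at rate
`O(1)`, and on `x = 0` it dissipates `Q_D` at rate `O(a)`. -/
theorem eventually_slow {A : X →L[ℝ] X} {D : Y →L[ℝ] Y} (hA : HasLyapunovForm A)
    (hD : HasLyapunovForm D) (B : X × Y →L[ℝ] X) (C : X →L[ℝ] Y) :
    ∀ᶠ a in 𝓝[>] (0 : ℝ), HasLyapunovForm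
      ((A.comp (.fst ℝ X Y) + a • B).prod (a • (C.comp (.fst ℝ X Y) + D.comp (.snd ℝ X Y)))) := by
  obtain ⟨Q, hQ, hQdis⟩ := hA
  obtain ⟨R, hR, hRdis⟩ := hD
  set fast : X × Y →L[ℝ] X × Y := (A.comp (.fst ℝ X Y)).prod 0
  set slow : X × Y →L[ℝ] X × Y := B.prod (C.comp (.fst ℝ X Y) + D.comp (.snd ℝ X Y))
  have hfast (z : X × Y) : dissipation (Q.prod R) fast z = dissipation Q A z.1 := by
    simp [fast, QuadraticMap.polar_prod]
  have hslow (z : X × Y) (hz : z.1 = 0) :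
      dissipation (Q.prod R) slow z = dissipation R D z.2 := by
    simp [slow, QuadraticMap.polar_prod, hz]
  have hdis := eventually_posDef_add_smul (P := dissipation (Q.prod R) fast)
    (R := dissipation (Q.prod R) slow) (fun z => hfast z ▸ hQdis.nonneg z.1) fun z hz h0 => by
      have hz1 : z.1 = 0 := hQdis.anisotropic _ (hfast z ▸ h0)
      have hz2 : z.2 ≠ 0 := fun hz2 => hz (Prod.ext hz1 hz2)
      exact hslow z hz1 ▸ hRdis _ hz2
  filter_upwards [hdis] with a ha
  refine ⟨Q.prod R, hQ.prod hR, ?_⟩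
  convert ha using 1
  ext z
  simp [fast, slow, polar_add_right, polar_smul_right]
  ring

end HasLyapunovForm

end LyapunovForms

section GlobalExistence

variable {X : Type*} [NormedAddCommGroup X] [NormedSpace ℝ X] {f : X → X} {K : NNReal}

theorem exists_solution_Icc_of_lipschitzWith_of_bounded [CompleteSpace X] {L : NNReal}
    (hf : LipschitzWith K f) (hL : ∀ x, ‖f x‖ ≤ L) (x₀ : X) {T : ℝ} (hT : 0 ≤ T) :
    ∃ α : ℝ → X, α 0 = x₀ ∧ ∀ t ∈ Icc 0 T, HasDerivWithinAt α (f (α t)) (Icc 0 T) t := by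
  lift T to NNReal using hT
  have hPL : IsPicardLindelof (fun _ : ℝ => f) (⟨0, ⟨le_rfl, T.2⟩⟩ : Icc (0 : ℝ) T) x₀
      (L * T) 0 L K :=
    .of_time_independent (fun x _ => hL x) hf.lipschitzOnWith (by simp)
  exact hPL.exists_eq_forall_mem_Icc_hasDerivWithinAt₀

theorem solution_Icc_unique_of_lipschitzWith (hf : LipschitzWith K f) {α β : ℝ → X} {S T t : ℝ}
    (hα : ∀ s ∈ Icc 0 S, HasDerivWithinAt α (f (α s)) (Icc 0 S) s)
    (hβ : ∀ s ∈ Icc 0 T, HasDerivWithinAt β (f (β s)) (Icc 0 T) s) (h0 : α 0 = β 0)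
    (htS : t ∈ Icc 0 S) (htT : t ∈ Icc 0 T) : α t = β t := by
  have hcont {γ : ℝ → X} {R : ℝ} (hR : t ∈ Icc 0 R)
      (hγ : ∀ s ∈ Icc 0 R, HasDerivWithinAt γ (f (γ s)) (Icc 0 R) s) : ContinuousOn γ (Icc 0 t) :=
    fun s hs => (hγ s ⟨hs.1, hs.2.trans hR.2⟩).continuousWithinAt.mono (Icc_subset_Icc_right hR.2)
  have hright {γ : ℝ → X} {R : ℝ} (hR : t ∈ Icc 0 R)
      (hγ : ∀ s ∈ Icc 0 R, HasDerivWithinAt γ (f (γ s)) (Icc 0 R) s) :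
      ∀ s ∈ Ico 0 t, HasDerivWithinAt γ (f (γ s)) (Ici s) s := fun s hs => by
    have hsR : s < R := hs.2.trans_le hR.2
    exact (hγ s ⟨hs.1, hsR.le⟩).mono_of_mem_nhdsWithin <|
      mem_of_superset (Icc_mem_nhdsGE hsR) (Icc_subset_Icc_left hs.1)
  exact ODE_solution_unique (v := fun _ => f) (fun _ => hf) (hcont htS hα) (hright htS hα)
    (hcont htT hβ) (hright htT hβ) h0 ⟨htS.1, le_rfl⟩

theorem exists_isForwardSolution_of_lipschitzWith_of_bounded [CompleteSpace X] {L : NNReal}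
    (hf : LipschitzWith K f) (hL : ∀ x, ‖f x‖ ≤ L) (x₀ : X) :
    ∃ x : ℝ → X, x 0 = x₀ ∧ IsForwardSolution f x := by
  choose α hα0 hα using fun n : ℕ =>
    exists_solution_Icc_of_lipschitzWith_of_bounded hf hL x₀ n.cast_nonneg
  refine ⟨fun t => α (⌈t⌉₊ + 1) t, hα0 _, fun t ht => ?_⟩
  have hlt : t < (⌈t⌉₊ + 1 : ℕ) := by
    push_cast
    exact (Nat.le_ceil t).trans_lt (lt_add_one _)
  have hnhds : Icc 0 ((⌈t⌉₊ + 1 : ℕ) : ℝ) ∈ 𝓝[Ici 0] t :=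
    mem_nhdsWithin.2 ⟨Iio _, isOpen_Iio, hlt, fun s hs => ⟨hs.2, hs.1.le⟩⟩
  refine ((hα _ t ⟨ht, hlt.le⟩).mono_of_mem_nhdsWithin hnhds).congr_of_eventuallyEq ?_ rfl
  filter_upwards [hnhds] with s hs
  have hs' : s ∈ Icc 0 ((⌈s⌉₊ + 1 : ℕ) : ℝ) :=
    ⟨hs.1, (Nat.le_ceil s).trans (Nat.cast_le.2 (Nat.le_succ _))⟩
  exact solution_Icc_unique_of_lipschitzWith hf (hα _) (hα _) (by simp only [hα0]) hs' hs

end GlobalExistence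

section IndirectMethod

open QuadraticMap Metric

variable {X : Type*} [NormedAddCommGroup X] [NormedSpace ℝ X] [FiniteDimensional ℝ X]
  {f : X → X} {p : X} {Q : QuadraticForm ℝ X} {A : X →L[ℝ] X} {μ ρ r : ℝ}

theorem exists_lipschitzWith_bounded_eqOn_closedBall (hf : ContDiffAt ℝ 1 f p) :
    ∃ (h : X → X) (K L : NNReal), LipschitzWith K h ∧ (∀ x, ‖h x‖ ≤ L) ∧
      ∃ r > 0, EqOn h f (closedBall p r) := by
  obtain ⟨R, hR, hfR⟩ := eventually_nhds_iff_ball.1 (hf.eventually (by simp))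
  let χ : ContDiffBump p := ⟨R / 4, R / 2, by positivity, by linarith⟩
  have hχf : ContDiff ℝ 1 fun x => χ x • f x := by
    refine contDiff_iff_contDiffAt.2 fun x => ?_
    by_cases hx : x ∈ tsupport χ
    · rw [χ.tsupport_eq] at hx
      exact χ.contDiffAt.smul (hfR x (closedBall_subset_ball (half_lt_self hR) hx))
    · refine (contDiffAt_const (c := 0)).congr_of_eventuallyEq ?_
      filter_upwards [notMem_tsupport_iff_eventuallyEq.1 hx] with y hy
      rw [hy, Pi.zero_apply, zero_smul]
  have hsupp : HasCompactSupport fun x => χ x • f x := χ.hasCompactSupport.smul_right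
  obtain ⟨K, hK⟩ := hχf.lipschitzWith_of_hasCompactSupport hsupp one_ne_zero
  obtain ⟨C, hC⟩ := hsupp.exists_bound_of_continuous hχf.continuous
  refine ⟨_, K, C.toNNReal, hK, fun x => (hC x).trans (Real.le_coe_toNNReal C), R / 4,
    by positivity, fun x hx => ?_⟩
  simp only [χ.one_of_mem_closedBall hx, one_smul]

/-- On `s`, the Lyapunov function `Q(x - p)` decays along `x' = f(x)` at exponential rate more
than `2μ`; the distance to `p`, which is comparable to its square root, then decays at rate `μ`. -/
def DecaysOn (Q : QuadraticForm ℝ X) (f : X → X) (p : X) (μ : ℝ) (s : Set X) : Prop :=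
  ∀ x ∈ s, x ≠ p → polar Q (x - p) (f x) < -(2 * μ) * Q (x - p)

theorem exists_decaysOn_closedBall (hf : HasFDerivAt f A p) (hp : f p = 0)
    (hdis : (dissipation Q A).PosDef) :
    ∃ μ > 0, ∃ ρ > 0, DecaysOn Q f p μ (closedBall p ρ) := by
  have hrate : ∀ᶠ ε in 𝓝[>] (0 : ℝ), (dissipation Q A + ε • -Q).PosDef :=
    eventually_posDef_add_smul hdis.nonneg fun x hx h0 => absurd h0 (hdis x hx).ne'
  obtain ⟨ε, hε, (hε0 : 0 < ε)⟩ := (hrate.and self_mem_nhdsWithin).exists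
  obtain ⟨m, hm, hmle⟩ := exists_mul_norm_sq_le hε
  set B := LinearMap.toContinuousBilinearMap Q.polarBilin
  have hrem := hf.isLittleO.def (c := m / (‖B‖ + 1)) (by positivity)
  obtain ⟨ρ, hρ, hball⟩ := nhds_basis_closedBall.eventually_iff.1 hrem
  refine ⟨ε / 2, by positivity, ρ, hρ, fun x hx hxp => ?_⟩
  have hy : 0 < ‖x - p‖ := norm_pos_iff.2 (sub_ne_zero.2 hxp)
  have hremainder : B (x - p) (f x - A (x - p)) < m * ‖x - p‖ ^ 2 := by
    have hx' : ‖f x - A (x - p)‖ ≤ m / (‖B‖ + 1) * ‖x - p‖ := by simpa [hp] using hball hx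
    calc B (x - p) (f x - A (x - p)) ≤ ‖B‖ * ‖x - p‖ * ‖f x - A (x - p)‖ :=
          (Real.le_norm_self _).trans (B.le_opNorm₂ _ _)
      _ ≤ ‖B‖ * ‖x - p‖ * (m / (‖B‖ + 1) * ‖x - p‖) := by gcongr
      _ = ‖B‖ / (‖B‖ + 1) * (m * ‖x - p‖ ^ 2) := by ring
      _ < m * ‖x - p‖ ^ 2 :=
          mul_lt_of_lt_one_left (by positivity) ((div_lt_one (by positivity)).2 (lt_add_one _))
  have hlinear := hmle (x - p)
  have hsplit : polar Q (x - p) (f x) = polar Q (x - p) (A (x - p)) +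
      B (x - p) (f x - A (x - p)) := by
    simp only [B, LinearMap.toContinuousBilinearMap_apply, polarBilin_apply_apply, polar_sub_right,
      add_sub_cancel]
  simp only [add_apply, smul_apply, neg_apply, dissipation_apply, smul_eq_mul] at hlinear
  linarith

theorem DecaysOn.le_mul_exp {m : ℝ} (hm : 0 < m) (hQ : ∀ y, m * ‖y‖ ^ 2 ≤ Q y)
    (hf : DecaysOn Q f p μ (closedBall p ρ)) (hμ : 0 ≤ μ) (hr : 0 < r) (hrρ : r ≤ ρ) {x : ℝ → X}
    (hx : IsForwardSolution f x) (h0 : Q (x 0 - p) ≤ m * r ^ 2) {t : ℝ} (ht : 0 ≤ t) :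
    Q (x t - p) ≤ m * r ^ 2 * Real.exp (-(2 * μ) * t) := by
  have hQderiv (s : ℝ) (hs : 0 ≤ s) : HasDerivWithinAt (fun s => Q (x s - p))
      (polar Q (x s - p) (f (x s))) (Ici 0) s :=
    hasDerivWithinAt_quadraticForm Q ((hx s hs).sub_const p)
  have hexp (s : ℝ) : HasDerivAt (fun s => m * r ^ 2 * Real.exp (-(2 * μ) * s))
      (-(2 * μ) * (m * r ^ 2 * Real.exp (-(2 * μ) * s))) s :=
    ((((hasDerivAt_id s).const_mul (-(2 * μ))).exp).const_mul (m * r ^ 2)).congr_deriv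
      (by simp only [id_eq]; ring)
  refine image_le_of_deriv_right_lt_deriv_boundary
    (fun s hs => (hQderiv s hs.1).continuousWithinAt.mono Icc_subset_Ici_self)
    (fun s hs => (hQderiv s hs.1).mono (Ici_subset_Ici.2 hs.1)) (by simpa using h0) hexp
    (fun s hs heq => ?_) (right_mem_Icc.2 ht)
  rw [← heq]
  refine hf _ ?_ ?_
  · have hle : m * ‖x s - p‖ ^ 2 ≤ m * r ^ 2 := by
      refine (hQ _).trans (heq.trans_le (mul_le_of_le_one_right (by positivity) ?_))
      exact Real.exp_le_one_iff.2 (mul_nonpos_of_nonpos_of_nonneg (by linarith) hs.1)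
    have hle' : ‖x s - p‖ ≤ r := le_of_sq_le_sq (le_of_mul_le_mul_left hle hm) hr.le
    exact mem_closedBall_iff_norm.2 (hle'.trans hrρ)
  · intro hxp
    have hpos : 0 < m * r ^ 2 * Real.exp (-(2 * μ) * s) := by positivity
    rw [← heq, hxp, sub_self, QuadraticMap.map_zero] at hpos
    exact hpos.false

theorem DecaysOn.eventually_dist_le (hf : DecaysOn Q f p μ (closedBall p ρ)) (hQ : Q.PosDef)
    (hμ : 0 ≤ μ) (hr : 0 < r) (hrρ : r ≤ ρ) :
    ∀ᶠ x₀ in 𝓝 p, ∀ x : ℝ → X, x 0 = x₀ → IsForwardSolution f x →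
      ∀ t, 0 ≤ t → dist (x t) p ≤ r * Real.exp (-μ * t) := by
  obtain ⟨m, hm, hmQ⟩ := exists_mul_norm_sq_le hQ
  have hcont : Continuous fun x₀ => Q (x₀ - p) := by
    have := continuous_quadraticForm Q
    fun_prop
  have hstart : ∀ᶠ x₀ in 𝓝 p, Q (x₀ - p) < m * r ^ 2 :=
    hcont.continuousAt.eventually_lt_const (by simpa using by positivity)
  filter_upwards [hstart] with x₀ hx₀ x hx0 hx t ht
  have hdecay := hf.le_mul_exp hm hmQ hμ hr hrρ hx (hx0 ▸ hx₀.le) ht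
  have hsq : m * dist (x t) p ^ 2 ≤ m * (r * Real.exp (-μ * t)) ^ 2 :=
    calc m * dist (x t) p ^ 2 ≤ Q (x t - p) := dist_eq_norm (x t) p ▸ hmQ _
      _ ≤ m * r ^ 2 * Real.exp (-(2 * μ) * t) := hdecay
      _ = m * (r * Real.exp (-μ * t)) ^ 2 := by rw [mul_pow, ← Real.exp_nat_mul]; ring_nf
  exact le_of_sq_le_sq (le_of_mul_le_mul_left hsq hm) (by positivity)

theorem DecaysOn.eventually_dist_le_radius (hf : DecaysOn Q f p μ (closedBall p ρ)) (hQ : Q.PosDef)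
    (hμ : 0 ≤ μ) (hr : 0 < r) (hrρ : r ≤ ρ) :
    ∀ᶠ x₀ in 𝓝 p, ∀ x : ℝ → X, x 0 = x₀ → IsForwardSolution f x →
      ∀ t, 0 ≤ t → dist (x t) p ≤ r := by
  filter_upwards [hf.eventually_dist_le hQ hμ hr hrρ] with x₀ hx₀ x hx0 hx t ht
  refine (hx₀ x hx0 hx t ht).trans (mul_le_of_le_one_right hr.le (Real.exp_le_one_iff.2 ?_))
  exact mul_nonpos_of_nonpos_of_nonneg (neg_nonpos.2 hμ) ht

/- The cutoff of `f` has global solutions, and those that start near `p` never reach the region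
where it differs from `f`. -/
theorem DecaysOn.eventually_exists_isForwardSolution (hf : DecaysOn Q f p μ (closedBall p ρ))
    (hQ : Q.PosDef) (hμ : 0 ≤ μ) (hρ : 0 < ρ) (hfC : ContDiffAt ℝ 1 f p) :
    ∀ᶠ x₀ in 𝓝 p, ∃ x : ℝ → X, x 0 = x₀ ∧ IsForwardSolution f x := by
  obtain ⟨h, K, L, hK, hL, R, hR, hhf⟩ := exists_lipschitzWith_bounded_eqOn_closedBall hfC
  have hdec : DecaysOn Q h p μ (closedBall p (min ρ R)) := fun x hx hxp => by
    rw [hhf (closedBall_subset_closedBall (min_le_right ρ R) hx)]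
    exact hf x (closedBall_subset_closedBall (min_le_left ρ R) hx) hxp
  filter_upwards [hdec.eventually_dist_le_radius hQ hμ (lt_min hρ hR) le_rfl] with x₀ hx₀
  obtain ⟨x, hx0, hx⟩ := exists_isForwardSolution_of_lipschitzWith_of_bounded hK hL x₀
  refine ⟨x, hx0, fun t ht => ?_⟩
  rw [← hhf (mem_closedBall.2 ((hx₀ x hx0 hx t ht).trans (min_le_right ρ R)))]
  exact hx t ht

theorem isLocallyAsymptoticallyStable_of_hasLyapunovForm (hf : ContDiffAt ℝ 1 f p)
    (hA : HasFDerivAt f A p) (hp : f p = 0) (hLyap : HasLyapunovForm A) :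
    IsLocallyAsymptoticallyStable f p := by
  obtain ⟨Q, hQ, hdis⟩ := hLyap
  obtain ⟨μ, hμ, ρ, hρ, hdec⟩ := exists_decaysOn_closedBall hA hp hdis
  refine ⟨hp, fun ε hε => ?_, ?_⟩
  · have hr : 0 < min ρ (ε / 2) := lt_min hρ (half_pos hε)
    obtain ⟨δ, hδ, hball⟩ := Metric.eventually_nhds_iff.1 <|
      (hdec.eventually_exists_isForwardSolution hQ hμ.le hρ hf).and
        (hdec.eventually_dist_le_radius hQ hμ.le hr (min_le_left _ _))
    refine ⟨δ, hδ, fun x₀ hx₀ => ⟨(hball hx₀).1, fun x hx0 hx t ht => ?_⟩⟩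
    exact ((hball hx₀).2 x hx0 hx t ht).trans_lt
      ((min_le_right _ _).trans_lt (half_lt_self hε))
  · obtain ⟨δ, hδ, hball⟩ :=
      Metric.eventually_nhds_iff.1 (hdec.eventually_dist_le hQ hμ.le hρ le_rfl)
    refine ⟨δ, hδ, fun x hx0 hx => tendsto_iff_dist_tendsto_zero.2 ?_⟩
    have hexp : Tendsto (fun t => ρ * Real.exp (-μ * t)) atTop (𝓝 0) := by
      have hlin : Tendsto (fun t => -μ * t) atTop atBot :=
        tendsto_id.const_mul_atTop_of_neg (neg_lt_zero.2 hμ)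
      simpa using (Real.tendsto_exp_atBot.comp hlin).const_mul ρ
    refine squeeze_zero' (.of_forall fun t => dist_nonneg) ?_ hexp
    filter_upwards [eventually_ge_atTop 0] with t ht using hball hx0 x rfl hx t ht

end IndirectMethod

section AggregateDynamics

open QuadraticMap ContinuousLinearMap

theorem posDef_sq : (QuadraticMap.sq (R := ℝ) (A := ℝ)).PosDef := fun _ => mul_self_pos.2

theorem polar_sq (x y : ℝ) : polar (QuadraticMap.sq (R := ℝ)) x y = 2 * x * y := by
  simp only [polar, QuadraticMap.sq_apply]
  ring

theorem hasLyapunovForm_neg_smul_id {c : ℝ} (hc : 0 < c) :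
    HasLyapunovForm (-c • ContinuousLinearMap.id ℝ ℝ) := by
  refine ⟨QuadraticMap.sq, posDef_sq, fun x hx => ?_⟩
  have hdis : dissipation QuadraticMap.sq (-c • ContinuousLinearMap.id ℝ ℝ) x = 2 * c * x ^ 2 := by
    simp [polar_sq]
    ring
  rw [hdis]
  positivity

/-- The linearized dynamics of one flexible load, with state its conductance and its filter, in
the absence of forcing by the other loads. -/
def flexibleBlock (w b a : ℝ) : ℝ × ℝ →L[ℝ] ℝ × ℝ :=
  let g := fst ℝ ℝ ℝ
  let h := snd ℝ ℝ ℝ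
  (-w • g + b • (h - g)).prod (-a • (h - g))

theorem hasLyapunovForm_flexibleBlock {w b a : ℝ} (hw : 0 < w) (hb : 0 < b) (ha : 0 < a) :
    HasLyapunovForm (flexibleBlock w b a) := by
  set Q := (a • QuadraticMap.sq (R := ℝ) (A := ℝ)).prod (b • QuadraticMap.sq (R := ℝ) (A := ℝ))
  refine ⟨Q, (posDef_sq.smul ha).prod (posDef_sq.smul hb), fun z hz => ?_⟩
  have hdis : dissipation Q (flexibleBlock w b a) z =
      2 * a * (w * z.1 ^ 2 + b * (z.2 - z.1) ^ 2) := by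
    simp [Q, flexibleBlock, QuadraticMap.polar_prod, polar_smul, polar_sq]
    ring
  rw [hdis]
  obtain hg | hg := eq_or_ne z.1 0
  · have hh : z.2 ≠ 0 := fun hh => hz (Prod.ext hg hh)
    rw [hg]
    simp only [sub_zero]
    positivity
  · positivity

/-- The linearized dynamics of the aggregates `(x, z, η)` when the filters are frozen: `x` and `z`
are the total flexible and inflexible conductances and `η = κ̄ φ - b ∑ ĝ`. -/
def fastField (w b K σF σI : ℝ) : ℝ × ℝ × ℝ →L[ℝ] ℝ × ℝ × ℝ :=
  let x := fst ℝ ℝ (ℝ × ℝ)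
  let z := (fst ℝ ℝ ℝ).comp (snd ℝ ℝ (ℝ × ℝ))
  let η := (snd ℝ ℝ ℝ).comp (snd ℝ ℝ (ℝ × ℝ))
  (-(w + b) • x + σF • (x + z) - η).prod ((-w • z + σI • (x + z)).prod (K • (x + z)))

/-- The energy of the fast field. Its dissipation does not control `η`, and controls `z` only if
the total gain `σI` is smaller than `w`. -/
def fastEnergy (w b K : ℝ) : QuadraticForm ℝ (ℝ × ℝ × ℝ) :=
  let x := LinearMap.fst ℝ ℝ (ℝ × ℝ)
  let z := LinearMap.fst ℝ ℝ ℝ ∘ₗ LinearMap.snd ℝ ℝ (ℝ × ℝ)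
  let η := LinearMap.snd ℝ ℝ ℝ ∘ₗ LinearMap.snd ℝ ℝ (ℝ × ℝ)
  (w * K) • linMulLin (x + z) (x + z) + (K * b) • linMulLin z z + w • linMulLin η η

/-- The indefinite correction to the energy of the fast field that dissipates the directions which
the energy misses. -/
def fastCorrection : QuadraticForm ℝ (ℝ × ℝ × ℝ) :=
  let x := LinearMap.fst ℝ ℝ (ℝ × ℝ)
  let z := LinearMap.fst ℝ ℝ ℝ ∘ₗ LinearMap.snd ℝ ℝ (ℝ × ℝ)
  let η := LinearMap.snd ℝ ℝ ℝ ∘ₗ LinearMap.snd ℝ ℝ (ℝ × ℝ)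
  linMulLin (x - z) η

theorem fastEnergy_posDef {w b K : ℝ} (hw : 0 < w) (hb : 0 < b) (hK : 0 < K) :
    (fastEnergy w b K).PosDef := by
  intro y hy
  have hval : fastEnergy w b K y =
      w * K * (y.1 + y.2.1) ^ 2 + K * b * y.2.1 ^ 2 + w * y.2.2 ^ 2 := by
    simp [fastEnergy]
    ring
  rw [hval]
  by_cases hz : y.2.1 = 0
  · by_cases hη : y.2.2 = 0
    · have hx : y.1 ≠ 0 := fun hx => hy (Prod.ext hx (Prod.ext hz hη))
      rw [hz, add_zero]
      positivity
    · positivity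
  · positivity

theorem dissipation_fastEnergy (w b K σF σI : ℝ) (y : ℝ × ℝ × ℝ) :
    dissipation (fastEnergy w b K) (fastField w b K σF σI) y =
      2 * K * w * (w - σF - σI) * (y.1 + y.2.1) ^ 2 + K * b * ((w + σI) * y.1 ^ 2 +
        (w - σI) * y.2.1 ^ 2 + (w - σI) * (y.1 + y.2.1) ^ 2) := by
  simp [fastEnergy, fastField, polar]
  ring

theorem dissipation_fastCorrection (w b K σF σI : ℝ) {y : ℝ × ℝ × ℝ} (hx : y.1 = 0) :
    dissipation fastCorrection (fastField w b K σF σI) y =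
      y.2.2 ^ 2 + K * y.2.1 ^ 2 - (σF + w - σI) * y.2.1 * y.2.2 := by
  simp [fastCorrection, fastField, polar, hx]
  ring

theorem hasLyapunovForm_fastField {w b K σF σI : ℝ} (hw : 0 < w) (hb : 0 < b) (hK : 0 < K)
    (hσF : 0 ≤ σF) (hσI : 0 ≤ σI) (hσ : σF + σI ≤ w) : HasLyapunovForm (fastField w b K σF σI) := by
  have hd : 0 ≤ w - σF - σI := by linarith
  have hτ : 0 ≤ w - σI := by linarith
  refine .of_semidefinite (N := fastCorrection) (fastEnergy_posDef hw hb hK) (fun y => ?_)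
    fun y hy h0 => ?_
  · rw [dissipation_fastEnergy]
    positivity
  rw [dissipation_fastEnergy] at h0
  have hx : y.1 = 0 := by
    by_contra hx
    have hpos : 0 < 2 * K * w * (w - σF - σI) * (y.1 + y.2.1) ^ 2 + K * b * ((w + σI) * y.1 ^ 2 +
        (w - σI) * y.2.1 ^ 2 + (w - σI) * (y.1 + y.2.1) ^ 2) := by positivity
    exact hpos.ne' h0
  have hz : (w - σI) * y.2.1 = 0 := by
    by_contra hz
    obtain ⟨hτ0, hz0⟩ := mul_ne_zero_iff.1 hz
    have : 0 < w - σI := hτ.lt_of_ne' hτ0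
    have hpos : 0 < 2 * K * w * (w - σF - σI) * (y.1 + y.2.1) ^ 2 + K * b * ((w + σI) * y.1 ^ 2 +
        (w - σI) * y.2.1 ^ 2 + (w - σI) * (y.1 + y.2.1) ^ 2) := by positivity
    exact hpos.ne' h0
  have hz' : σF * y.2.1 = 0 := by
    obtain hτ0 | hz0 := mul_eq_zero.1 hz
    · rw [show σF = 0 by linarith, zero_mul]
    · rw [hz0, mul_zero]
  have hcross : (σF + w - σI) * y.2.1 = 0 := by linear_combination hz + hz'
  rw [dissipation_fastCorrection _ _ _ _ _ hx, hcross, zero_mul, sub_zero]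
  by_cases hz0 : y.2.1 = 0
  · have hη : y.2.2 ≠ 0 := fun hη => hy (Prod.ext hx (Prod.ext hz0 hη))
    positivity
  · positivity

/-- The linearized dynamics of the aggregates `((x, z, η), U)`, where `U` is the sum of the
filters. It does not depend on the individual loads. -/
def aggregateField (w b K σF σI a : ℝ) : (ℝ × ℝ × ℝ) × ℝ →L[ℝ] (ℝ × ℝ × ℝ) × ℝ :=
  let x := fst ℝ ℝ (ℝ × ℝ)
  let backaction : (ℝ × ℝ × ℝ) × ℝ →L[ℝ] ℝ × ℝ × ℝ :=
    (0 : _ →L[ℝ] ℝ).prod ((0 : _ →L[ℝ] ℝ).prod (-b • (x.comp (fst ℝ _ ℝ) - snd ℝ _ ℝ)))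
  ((fastField w b K σF σI).comp (fst ℝ _ ℝ) + a • backaction).prod
    (a • (x.comp (fst ℝ _ ℝ) + ((-1 : ℝ) • ContinuousLinearMap.id ℝ ℝ).comp (snd ℝ _ ℝ)))

theorem eventually_hasLyapunovForm_aggregateField {w b K σF σI : ℝ} (hw : 0 < w) (hb : 0 < b)
    (hK : 0 < K) (hσF : 0 ≤ σF) (hσI : 0 ≤ σI) (hσ : σF + σI ≤ w) :
    ∀ᶠ a in 𝓝[>] (0 : ℝ), HasLyapunovForm (aggregateField w b K σF σI a) :=
  (hasLyapunovForm_fastField hw hb hK hσF hσI hσ).eventually_slow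
    (hasLyapunovForm_neg_smul_id one_pos) _ _

end AggregateDynamics

section LinearizedLoop

open ContinuousLinearMap

variable {F I : Type*} [Fintype F] [Fintype I]

/-- The conductance of load `i`, as a linear function of the state. -/
def conductance (i : F ⊕ I) : State F I →L[ℝ] ℝ := (proj i).comp (fst ℝ _ _)

/-- The shared state `φ`, as a linear function of the state. -/
def sharedState : State F I →L[ℝ] ℝ := (fst ℝ ℝ (F → ℝ)).comp (snd ℝ _ _)

/-- The filter state of the flexible load `i`, as a linear function of the state. -/
def filterState (i : F) : State F I →L[ℝ] ℝ := (proj i).comp ((snd ℝ ℝ _).comp (snd ℝ _ _))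

/-- The form of the linearized closed loop: `w` is the sensitivity of the power of a load to its
own conductance, `-s i` its sensitivity to the total conductance, and `k` the gain from the total
conductance to the shared state. -/
def linearization (w b k : ℝ) (κ : F → ℝ) (s : F ⊕ I → ℝ) (a : ℝ) : State F I →L[ℝ] State F I :=
  let deltaP (i : F ⊕ I) := w • conductance i - s i • ∑ j, conductance j
  (pi (Sum.elim
    (fun i => -deltaP (.inl i) - κ i • sharedState + b • (filterState i - conductance (.inl i)))
    (fun j => -deltaP (.inr j)))).prod
  ((k • ∑ j, conductance j).prod
    (pi fun i => -a • (filterState i - conductance (.inl i))))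

/-- The aggregate coordinates `((x, z, η), U)` of a state. -/
def aggregates (b : ℝ) (κ : F → ℝ) : State F I →L[ℝ] (ℝ × ℝ × ℝ) × ℝ :=
  ((∑ i, conductance (.inl i)).prod ((∑ j, conductance (.inr j)).prod
    ((∑ i, κ i) • sharedState - b • ∑ i, filterState i))).prod (∑ i, filterState i)

theorem aggregates_linearization (w b k : ℝ) (κ : F → ℝ) (s : F ⊕ I → ℝ) (a : ℝ)
    (y : State F I) :
    aggregates b κ (linearization w b k κ s a y) =
      aggregateField w b ((∑ i, κ i) * k) (∑ i, s (.inl i)) (∑ j, s (.inr j)) a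
        (aggregates b κ y) := by
  refine Prod.ext (Prod.ext ?_ (Prod.ext ?_ ?_)) ?_ <;>
    simp [aggregates, linearization, aggregateField, fastField, conductance, sharedState,
      filterState, Finset.sum_add_distrib, Finset.sum_sub_distrib, ← Finset.mul_sum,
      ← Finset.sum_mul] <;>
    ring

/-- The forcing of the flexible blocks by the aggregates, in which the shared state is recovered
as `φ = (η + b U) / κ̄`. -/
def flexibleForcing (b : ℝ) (κ : F → ℝ) (s : F ⊕ I → ℝ) : (ℝ × ℝ × ℝ) × ℝ →L[ℝ] (F → ℝ × ℝ) :=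
  let x := (fst ℝ ℝ (ℝ × ℝ)).comp (fst ℝ _ ℝ)
  let z := ((fst ℝ ℝ ℝ).comp (snd ℝ ℝ (ℝ × ℝ))).comp (fst ℝ _ ℝ)
  let η := ((snd ℝ ℝ ℝ).comp (snd ℝ ℝ (ℝ × ℝ))).comp (fst ℝ _ ℝ)
  let U := snd ℝ (ℝ × ℝ × ℝ) ℝ
  pi fun i => (s (.inl i) • (x + z) - (κ i / ∑ j, κ j) • (η + b • U)).prod 0

/-- The forcing of the inflexible loads by the aggregates. -/
def inflexibleForcing (s : F ⊕ I → ℝ) : (ℝ × ℝ × ℝ) × ℝ →L[ℝ] (I → ℝ) :=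
  let x := (fst ℝ ℝ (ℝ × ℝ)).comp (fst ℝ _ ℝ)
  let z := ((fst ℝ ℝ ℝ).comp (snd ℝ ℝ (ℝ × ℝ))).comp (fst ℝ _ ℝ)
  pi fun j => s (.inr j) • (x + z)

/-- The coordinates in which the linearized closed loop is a cascade: the aggregates drive the
individual flexible loads and their filters, and the individual inflexible loads. -/
def cascadeCoordinates (b : ℝ) (κ : F → ℝ) :
    State F I →L[ℝ] (((ℝ × ℝ × ℝ) × ℝ) × (F → ℝ × ℝ)) × (I → ℝ) :=
  ((aggregates b κ).prod (pi fun i => (conductance (.inl i)).prod (filterState i))).prod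
    (pi fun j => conductance (.inr j))

theorem cascadeCoordinates_injective (b : ℝ) {κ : F → ℝ} (hκ : ∑ i, κ i ≠ 0) :
    Function.Injective (cascadeCoordinates b κ : State F I → _) := by
  refine (injective_iff_map_eq_zero _).2 fun y hy => ?_
  obtain ⟨⟨hagg, hflex⟩, hinflex⟩ : (aggregates b κ y = 0 ∧
      (fun i => (y.1 (.inl i), y.2.2 i)) = 0) ∧ (fun j => y.1 (.inr j)) = 0 :=
    ⟨Prod.ext_iff.1 (congrArg Prod.fst hy), congrArg Prod.snd hy⟩
  have hconductance : y.1 = 0 := by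
    ext (i | j)
    · exact congrArg Prod.fst (congrFun hflex i)
    · exact congrFun hinflex j
  have hfilter : y.2.2 = 0 := funext fun i => congrArg Prod.snd (congrFun hflex i)
  have hη : (∑ i, κ i) * y.2.1 - b * ∑ i, y.2.2 i = 0 := by
    simpa [aggregates, sharedState, filterState] using congrArg (fun v => v.1.2.2) hagg
  have hshared : y.2.1 = 0 := by simpa [hfilter, hκ] using hη
  exact Prod.ext hconductance (Prod.ext hshared hfilter)

theorem eventually_hasLyapunovForm_linearization {w b k : ℝ} (hw : 0 < w) (hb : 0 < b) (hk : 0 < k)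
    {κ : F → ℝ} (hκ : 0 < ∑ i, κ i) {s : F ⊕ I → ℝ} (hs : ∀ i, 0 ≤ s i) (hsw : ∑ i, s i ≤ w) :
    ∀ᶠ a in 𝓝[>] (0 : ℝ), HasLyapunovForm (linearization w b k κ s a) := by
  have haggregate := eventually_hasLyapunovForm_aggregateField hw hb (mul_pos hκ hk)
    (Finset.sum_nonneg fun i _ => hs (.inl i)) (Finset.sum_nonneg fun j _ => hs (.inr j))
    (Fintype.sum_sum_type s ▸ hsw)
  filter_upwards [haggregate, self_mem_nhdsWithin] with a ha ha0
  have hflexible := ha.cascade (.pi fun _ : F => hasLyapunovForm_flexibleBlock hw hb ha0)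
    (flexibleForcing b κ s)
  have hall := hflexible.cascade (.pi fun _ : I => hasLyapunovForm_neg_smul_id hw)
    ((inflexibleForcing s).comp (fst ℝ _ _))
  refine hall.of_injective (cascadeCoordinates_injective b hκ.ne') fun y => ?_
  refine Prod.ext (Prod.ext (aggregates_linearization w b k κ s a y) (funext fun i => ?_))
    (funext fun j => ?_)
  · simp [cascadeCoordinates, aggregates, linearization, flexibleForcing, flexibleBlock,
      conductance, sharedState, filterState]
    field_simp
    ring
  · simp [cascadeCoordinates, aggregates, linearization, inflexibleForcing, conductance]
    ring

end LinearizedLoop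

namespace StarNetwork

section PowerCurve

variable {F I : Type*} (S : StarNetwork F I)

theorem voltage_pos (hE : 0 < S.E) (hgl : 0 < S.gl) {s : ℝ} (hs : 0 ≤ s) : 0 < S.voltage s := by
  unfold voltage
  positivity

theorem hasDerivAt_voltage_sq {s : ℝ} (hs : s + S.gl ≠ 0) :
    HasDerivAt (fun t => S.voltage t ^ 2) (-(2 * S.voltage s ^ 2 / (s + S.gl))) s := by
  refine (((hasDerivAt_const s (S.E * S.gl)).div
    ((hasDerivAt_id s).add_const S.gl) hs).fun_pow 2).congr_deriv ?_
  simp [voltage]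
  field_simp

theorem totalPower_eq_voltage_sq_mul (s : ℝ) : S.totalPower s = S.voltage s ^ 2 * s := by
  rw [totalPower, voltage, div_pow]

theorem Pmax_sub_totalPower {s : ℝ} (hs : s + S.gl ≠ 0) :
    S.Pmax - S.totalPower s = S.E ^ 2 * S.gl * (S.gl - s) ^ 2 / (4 * (s + S.gl) ^ 2) := by
  rw [Pmax, totalPower]
  field_simp
  ring

theorem totalPower_gl (hgl : 0 < S.gl) : S.totalPower S.gl = S.Pmax := by
  have h := S.Pmax_sub_totalPower (s := S.gl) (by positivity)
  rw [sub_self, zero_pow two_ne_zero, mul_zero, zero_div] at h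
  exact (sub_eq_zero.1 h).symm

theorem totalPower_le_Pmax (hgl : 0 < S.gl) {s : ℝ} (hs : 0 ≤ s) : S.totalPower s ≤ S.Pmax := by
  rw [← sub_nonneg, S.Pmax_sub_totalPower (by positivity)]
  positivity

theorem totalPower_eq_Pmax_iff (hE : 0 < S.E) (hgl : 0 < S.gl) {s : ℝ} (hs : 0 ≤ s) :
    S.totalPower s = S.Pmax ↔ s = S.gl := by
  have hne : s + S.gl ≠ 0 := by positivity
  rw [eq_comm, ← sub_eq_zero, S.Pmax_sub_totalPower hne, eq_comm (a := s),
    ← sub_eq_zero (a := S.gl)]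
  simp [hE.ne', hgl.ne', hne]

/-- The derivative of the total power with respect to the total conductance `s`, valid away from
the pole `s = -g_l`. -/
def marginalPower (s : ℝ) : ℝ := (S.E * S.gl) ^ 2 * (S.gl - s) / (s + S.gl) ^ 3

theorem hasDerivAt_totalPower {s : ℝ} (hs : s + S.gl ≠ 0) :
    HasDerivAt S.totalPower (S.marginalPower s) s := by
  have hsq : HasDerivAt (fun t : ℝ => (t + S.gl) ^ 2) (2 * (s + S.gl)) s := by
    simpa using ((hasDerivAt_id s).add_const S.gl).fun_pow 2
  refine (((hasDerivAt_const s ((S.E * S.gl) ^ 2)).div hsq (pow_ne_zero 2 hs)).mul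
    (hasDerivAt_id s)).congr_deriv ?_
  simp only [id, Pi.div_apply, marginalPower]
  field_simp
  ring

theorem hasDerivAt_marginalPower {s : ℝ} (hs : s + S.gl ≠ 0) :
    HasDerivAt S.marginalPower ((S.E * S.gl) ^ 2 * (2 * s - 4 * S.gl) / (s + S.gl) ^ 4) s := by
  have hcube : HasDerivAt (fun t : ℝ => (t + S.gl) ^ 3) (3 * (s + S.gl) ^ 2) s := by
    simpa using ((hasDerivAt_id s).add_const S.gl).fun_pow 3
  refine ((((hasDerivAt_id s).const_sub S.gl).const_mul ((S.E * S.gl) ^ 2)).div hcube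
    (pow_ne_zero 3 hs)).congr_deriv ?_
  simp only [id]
  field_simp
  ring

theorem marginalPower_pos (hE : 0 < S.E) (hgl : 0 < S.gl) {s : ℝ} (hs : 0 ≤ s) (hsl : s < S.gl) :
    0 < S.marginalPower s := by
  have := sub_pos.2 hsl
  unfold marginalPower
  positivity

theorem marginalPower_eq_zero_iff (hE : 0 < S.E) (hgl : 0 < S.gl) {s : ℝ} (hs : 0 ≤ s) :
    S.marginalPower s = 0 ↔ s = S.gl := by
  have hne : s + S.gl ≠ 0 := by positivity
  simp [marginalPower, hE.ne', hgl.ne', hne, sub_eq_zero, eq_comm]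

theorem continuousOn_totalPower (hgl : 0 < S.gl) : ContinuousOn S.totalPower (Icc 0 S.gl) :=
  fun _ hs => (S.hasDerivAt_totalPower (by linarith [hs.1])).continuousAt.continuousWithinAt

theorem strictMonoOn_totalPower (hE : 0 < S.E) (hgl : 0 < S.gl) :
    StrictMonoOn S.totalPower (Icc 0 S.gl) := by
  refine strictMonoOn_of_deriv_pos (convex_Icc _ _) (S.continuousOn_totalPower hgl) fun s hs => ?_
  rw [interior_Icc] at hs
  rw [(S.hasDerivAt_totalPower (by linarith [hs.1])).deriv]
  exact S.marginalPower_pos hE hgl hs.1.le hs.2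

theorem exists_totalPower_eq (hgl : 0 < S.gl) {D : ℝ} (hD : 0 ≤ D) (hDmax : D < S.Pmax) :
    ∃ s ∈ Ico 0 S.gl, S.totalPower s = D := by
  refine intermediate_value_Ico hgl.le (S.continuousOn_totalPower hgl) ⟨?_, ?_⟩
  · simpa [totalPower] using hD
  · rwa [S.totalPower_gl hgl]

end PowerCurve

section SheddingParameters

variable {F I : Type*} [Fintype F] [Nonempty F] (S : StarNetwork F I)

theorem κbar_pos (hκ : ∀ i, 0 < S.κ i) : 0 < S.κbar :=
  Finset.sum_pos (fun i _ => hκ i) Finset.univ_nonempty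

theorem sum_κ_div_κbar (hκ : ∀ i, 0 < S.κ i) : ∑ i, S.κ i / S.κbar = 1 := by
  rw [← Finset.sum_div]
  exact div_self (S.κbar_pos hκ).ne'

end SheddingParameters

variable {F I : Type*} [Fintype F] [Fintype I] (S : StarNetwork F I)

section Linearization

theorem hasDerivAt_totalDeltaP {s : ℝ} (hs : s + S.gl ≠ 0) :
    HasDerivAt S.totalDeltaP (S.marginalPower s) s :=
  (S.hasDerivAt_totalPower hs).sub_const S.totalDemand

theorem deriv_totalDeltaP {s : ℝ} (hs : s + S.gl ≠ 0) :
    deriv S.totalDeltaP s = S.marginalPower s :=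
  (S.hasDerivAt_totalDeltaP hs).deriv

theorem deriv_totalDeltaP_eventuallyEq {s : ℝ} (hs : s + S.gl ≠ 0) :
    deriv S.totalDeltaP =ᶠ[𝓝 s] S.marginalPower := by
  filter_upwards [(continuousAt_id.add continuousAt_const).eventually_ne hs] with t ht
  exact S.deriv_totalDeltaP ht

/-- The derivative, with respect to the total conductance `s`, of the right-hand side of the shared
state's equation. -/
def sharedGain (s : ℝ) : ℝ :=
  S.marginalPower s ^ 2 +
    S.totalDeltaP s * ((S.E * S.gl) ^ 2 * (2 * s - 4 * S.gl) / (s + S.gl) ^ 4)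

theorem sharedGain_gl_pos (hE : 0 < S.E) (hgl : 0 < S.gl) (hD : S.Pmax < S.totalDemand) :
    0 < S.sharedGain S.gl := by
  have heq : S.sharedGain S.gl = (S.totalDemand - S.Pmax) * (S.E ^ 2 / (8 * S.gl)) := by
    rw [sharedGain, marginalPower, totalDeltaP, S.totalPower_gl hgl]
    field_simp
    ring
  rw [heq]
  have := sub_pos.2 hD
  positivity

theorem sharedGain_pos_of_lt (hE : 0 < S.E) (hgl : 0 < S.gl) {s : ℝ} (hs : 0 ≤ s) (hsl : s < S.gl)
    (h : S.totalDeltaP s = 0) : 0 < S.sharedGain s := by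
  rw [sharedGain, h, zero_mul, add_zero]
  exact pow_pos (S.marginalPower_pos hE hgl hs hsl) 2

theorem hasDerivAt_totalDeltaP_mul_deriv {s : ℝ} (hs : s + S.gl ≠ 0) :
    HasDerivAt (fun t => S.totalDeltaP t * deriv S.totalDeltaP t) (S.sharedGain s) s := by
  refine ((S.hasDerivAt_totalDeltaP hs).mul ((S.hasDerivAt_marginalPower hs).congr_of_eventuallyEq
    (S.deriv_totalDeltaP_eventuallyEq hs))).congr_deriv ?_
  rw [S.deriv_totalDeltaP hs, sharedGain, sq (S.marginalPower s)]

theorem contDiffAt_totalDeltaP_mul_deriv {s : ℝ} (hs : s + S.gl ≠ 0) :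
    ContDiffAt ℝ 1 (fun t => S.totalDeltaP t * deriv S.totalDeltaP t) s := by
  have hadd : ContDiffAt ℝ 1 (fun t : ℝ => t + S.gl) s := contDiffAt_id.add contDiffAt_const
  have hmarginal : ContDiffAt ℝ 1 S.marginalPower s :=
    (contDiffAt_const.mul (contDiffAt_const.sub contDiffAt_id)).div (hadd.pow 3)
      (pow_ne_zero 3 hs)
  have htotal : ContDiffAt ℝ 1 S.totalDeltaP s :=
    ((contDiffAt_const.div (hadd.pow 2) (pow_ne_zero 2 hs)).mul contDiffAt_id).sub contDiffAt_const
  exact htotal.mul (hmarginal.congr_of_eventuallyEq (S.deriv_totalDeltaP_eventuallyEq hs))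

theorem contDiff_totalConductance : ContDiff ℝ 1 (totalConductance : (F ⊕ I → ℝ) → ℝ) := by
  unfold totalConductance
  fun_prop

theorem hasFDerivAt_totalConductance (p : State F I) :
    HasFDerivAt (fun x : State F I => totalConductance x.1) (∑ j, conductance j) p := by
  unfold totalConductance
  exact HasFDerivAt.fun_sum fun j _ => (conductance j).hasFDerivAt

theorem contDiffAt_deltaP {p : State F I} (hp : totalConductance p.1 + S.gl ≠ 0) (i : F ⊕ I) :
    ContDiffAt ℝ 1 (fun x : State F I => S.deltaP x.1 i) p := by
  have htotal : ContDiffAt ℝ 1 (fun x : State F I => totalConductance x.1) p :=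
    (contDiff_totalConductance.comp contDiff_fst).contDiffAt
  exact (((contDiffAt_const.div (htotal.add contDiffAt_const) hp).pow 2).mul
    (by fun_prop)).sub contDiffAt_const

theorem hasFDerivAt_deltaP {p : State F I} (hp : totalConductance p.1 + S.gl ≠ 0) (i : F ⊕ I) :
    HasFDerivAt (fun x : State F I => S.deltaP x.1 i)
      (S.voltage (totalConductance p.1) ^ 2 • conductance i -
        (2 * S.voltage (totalConductance p.1) ^ 2 * p.1 i / (totalConductance p.1 + S.gl)) •
          ∑ j, conductance j) p := by
  refine ((((S.hasDerivAt_voltage_sq hp).comp_hasFDerivAt p (hasFDerivAt_totalConductance p)).mul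
    (conductance i).hasFDerivAt).sub_const (S.P0 i)).congr_fderiv
    (ContinuousLinearMap.ext fun y => ?_)
  simp [conductance]
  ring

theorem contDiffAt_vcsField (a b : ℝ) {p : State F I} (hp : totalConductance p.1 + S.gl ≠ 0) :
    ContDiffAt ℝ 1 (S.vcsField a b) p := by
  refine (contDiffAt_pi.2 ?_).prodMk (.prodMk ?_ (by fun_prop))
  · rintro (i | j)
    · exact ((S.contDiffAt_deltaP hp _).neg.sub (by fun_prop)).add (by fun_prop)
    · exact (S.contDiffAt_deltaP hp _).neg
  · exact (S.contDiffAt_totalDeltaP_mul_deriv hp).comp p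
      (contDiff_totalConductance.comp contDiff_fst).contDiffAt

theorem hasFDerivAt_vcsField (a b : ℝ) {p : State F I} (hp : totalConductance p.1 + S.gl ≠ 0) :
    HasFDerivAt (S.vcsField a b)
      (linearization (S.voltage (totalConductance p.1) ^ 2) b
        (S.sharedGain (totalConductance p.1)) S.κ
        (fun i => 2 * S.voltage (totalConductance p.1) ^ 2 * p.1 i /
          (totalConductance p.1 + S.gl)) a) p := by
  have htracking (i : F) : HasFDerivAt (fun x : State F I => x.2.2 i - x.1 (.inl i))
      (filterState i - conductance (.inl i)) p :=
    (filterState i - conductance (.inl i)).hasFDerivAt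
  refine (hasFDerivAt_pi.2 ?_).prodMk (.prodMk ?_ (hasFDerivAt_pi.2 fun i => ?_))
  · rintro (i | j)
    · exact ((S.hasFDerivAt_deltaP hp _).neg.sub
        (sharedState.hasFDerivAt.const_mul (S.κ i))).add ((htracking i).const_mul b)
    · exact (S.hasFDerivAt_deltaP hp _).neg
  · exact (S.hasDerivAt_totalDeltaP_mul_deriv hp).comp_hasFDerivAt p
      (hasFDerivAt_totalConductance p)
  · exact (htracking i).const_mul (-a)

end Linearization

theorem totalConductance_nonneg {g : F ⊕ I → ℝ} (hg : ∀ i, 0 ≤ g i) : 0 ≤ totalConductance g :=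
  Finset.sum_nonneg fun i _ => hg i

theorem eventually_isLocallyAsymptoticallyStable [Nonempty F] (hE : 0 < S.E) (hgl : 0 < S.gl)
    (hκ : ∀ i, 0 < S.κ i) {b : ℝ} (hb : 0 < b) {p : State F I} (hp : ∀ i, 0 ≤ p.1 i)
    (hpl : totalConductance p.1 ≤ S.gl) (hgain : 0 < S.sharedGain (totalConductance p.1))
    (heq : ∀ a, a ≠ 0 → S.vcsField a b p = 0) :
    ∀ᶠ a in 𝓝[>] (0 : ℝ), IsLocallyAsymptoticallyStable (S.vcsField a b) p := by
  have hG := totalConductance_nonneg hp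
  have hv := S.voltage_pos hE hgl hG
  have hne : totalConductance p.1 + S.gl ≠ 0 := by positivity
  have hsum : ∑ i, 2 * S.voltage (totalConductance p.1) ^ 2 * p.1 i /
      (totalConductance p.1 + S.gl) ≤ S.voltage (totalConductance p.1) ^ 2 := by
    rw [← Finset.sum_div, ← Finset.mul_sum, div_le_iff₀ (by positivity), mul_comm 2, mul_assoc]
    change _ * (2 * totalConductance p.1) ≤ _
    gcongr
    linarith
  filter_upwards [eventually_hasLyapunovForm_linearization (by positivity) hb hgain
    (S.κbar_pos hκ) (fun i => by have := hp i; positivity) hsum, self_mem_nhdsWithin] with a ha ha0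
  exact isLocallyAsymptoticallyStable_of_hasLyapunovForm (S.contDiffAt_vcsField a b hne)
    (S.hasFDerivAt_vcsField a b hne) (heq a ha0.ne') ha

section Equilibria

theorem sum_deltaP (g : F ⊕ I → ℝ) :
    ∑ i, S.deltaP g i = S.totalDeltaP (totalConductance g) := by
  simp only [deltaP, totalDeltaP, totalDemand, Finset.sum_sub_distrib, S.sum_power]

theorem totalDeltaP_of_proportional [Nonempty F] (hκ : ∀ i, 0 < S.κ i) {g : F ⊕ I → ℝ} {c : ℝ}
    (hF : ∀ i, S.deltaP g (.inl i) = S.κ i / S.κbar * c) (hI : ∀ j, S.deltaP g (.inr j) = 0) :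
    S.totalDeltaP (totalConductance g) = c := by
  rw [← S.sum_deltaP, Fintype.sum_sum_type, Fintype.sum_congr _ _ hF, Fintype.sum_congr _ _ hI,
    ← Finset.sum_mul, S.sum_κ_div_κbar hκ, one_mul, Finset.sum_const_zero, add_zero]

theorem exists_power_eq (hE : 0 < S.E) (hgl : 0 < S.gl) {q : F ⊕ I → ℝ} (hq : ∀ i, 0 ≤ q i)
    {s : ℝ} (hs : 0 ≤ s) (hsq : S.totalPower s = ∑ i, q i) :
    ∃ g : F ⊕ I → ℝ, (∀ i, 0 ≤ g i) ∧ totalConductance g = s ∧ ∀ i, S.power g i = q i := by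
  have hv := (pow_pos (S.voltage_pos hE hgl hs) 2).ne'
  have htotal : totalConductance (fun i => q i / S.voltage s ^ 2) = s := by
    rw [totalConductance, ← Finset.sum_div, ← hsq, S.totalPower_eq_voltage_sq_mul,
      mul_div_cancel_left₀ _ hv]
  refine ⟨_, fun i => div_nonneg (hq i) (sq_nonneg _), htotal, fun i => ?_⟩
  rw [power, htotal, mul_div_cancel₀ _ hv]

theorem state_eq_of_deltaP_eq (hE : 0 < S.E) (hgl : 0 < S.gl) {x y : State F I}
    (hx : ∀ i, 0 ≤ x.1 i) (htotal : totalConductance x.1 = totalConductance y.1)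
    (hdelta : ∀ i, S.deltaP x.1 i = S.deltaP y.1 i) (hshared : x.2.1 = y.2.1)
    (hfx : ∀ i, x.2.2 i = x.1 (.inl i)) (hfy : ∀ i, y.2.2 i = y.1 (.inl i)) : x = y := by
  have hv := (pow_pos (S.voltage_pos hE hgl (totalConductance_nonneg hx)) 2).ne'
  have hg : x.1 = y.1 := funext fun i => by
    have h := hdelta i
    rw [deltaP, deltaP, power, power, ← htotal, sub_left_inj] at h
    exact mul_left_cancel₀ hv h
  exact Prod.ext hg (Prod.ext hshared (funext fun i => by rw [hfx, hfy, hg]))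

theorem vcsField_eq_zero_iff {a : ℝ} (ha : a ≠ 0) (b : ℝ) (x : State F I) :
    S.vcsField a b x = 0 ↔
      (∀ i, S.deltaP x.1 (.inl i) = -S.κ i * x.2.1) ∧ (∀ j, S.deltaP x.1 (.inr j) = 0) ∧
      S.totalDeltaP (totalConductance x.1) * deriv S.totalDeltaP (totalConductance x.1) = 0 ∧
      ∀ i, x.2.2 i = x.1 (.inl i) := by
  simp only [vcsField, Prod.ext_iff, funext_iff, Sum.forall, Prod.fst_zero, Prod.snd_zero,
    Pi.zero_apply, Sum.elim_inl, Sum.elim_inr]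
  constructor
  · rintro ⟨⟨hF, hI⟩, hshared, hfilter⟩
    have htracking (i : F) : x.2.2 i = x.1 (.inl i) :=
      sub_eq_zero.1 ((mul_eq_zero.1 (hfilter i)).resolve_left (neg_ne_zero.2 ha))
    refine ⟨fun i => ?_, fun j => neg_eq_zero.1 (hI j), hshared, htracking⟩
    linear_combination -hF i + b * htracking i
  · rintro ⟨hF, hI, hshared, hfilter⟩
    simp [hF, hI, hshared, hfilter]

end Equilibria

section ProportionalAllocation

theorem totalConductance_of_mem_proportionalAllocation [Nonempty F] (hE : 0 < S.E) (hgl : 0 < S.gl)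
    (hκ : ∀ i, 0 < S.κ i) {x : State F I} (hx : x ∈ S.proportionalAllocation) :
    totalConductance x.1 = S.gl := by
  obtain ⟨hnonneg, hF, hI, -, -⟩ := hx
  have h := S.totalDeltaP_of_proportional hκ hF hI
  exact (S.totalPower_eq_Pmax_iff hE hgl (totalConductance_nonneg hnonneg)).1 (sub_left_inj.1 h)

theorem proportionalAllocation_subsingleton [Nonempty F] (hE : 0 < S.E) (hgl : 0 < S.gl)
    (hκ : ∀ i, 0 < S.κ i) : S.proportionalAllocation.Subsingleton := by
  intro x hx y hy
  have htotal : totalConductance x.1 = totalConductance y.1 :=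
    (S.totalConductance_of_mem_proportionalAllocation hE hgl hκ hx).trans
      (S.totalConductance_of_mem_proportionalAllocation hE hgl hκ hy).symm
  obtain ⟨hx0, hxF, hxI, hxφ, hxf⟩ := hx
  obtain ⟨-, hyF, hyI, hyφ, hyf⟩ := hy
  refine S.state_eq_of_deltaP_eq hE hgl hx0 htotal ?_ (hxφ.trans hyφ.symm) hxf hyf
  rintro (i | j)
  · rw [hxF, hyF]
  · rw [hxI, hyI]

theorem proportionalAllocation_nonempty [Nonempty F] (hE : 0 < S.E) (hgl : 0 < S.gl)
    (hκ : ∀ i, 0 < S.κ i) (hI : ∀ j : I, 0 ≤ S.P0 (.inr j))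
    (hshed : ∀ i : F, S.κ i / S.κbar * (S.totalDemand - S.Pmax) ≤ S.P0 (.inl i)) :
    S.proportionalAllocation.Nonempty := by
  let excess : F ⊕ I → ℝ := Sum.elim (fun i => S.κ i / S.κbar * (S.Pmax - S.totalDemand)) 0
  have hnonneg (i : F ⊕ I) : 0 ≤ S.P0 i + excess i := by
    rcases i with i | j
    · simp only [excess, Sum.elim_inl]
      linarith [hshed i]
    · simpa [excess] using hI j
  have hsum : S.totalPower S.gl = ∑ i, (S.P0 i + excess i) := by
    have hexcess : ∑ i, excess i = S.Pmax - S.totalDemand := by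
      simp [excess, ← Finset.sum_mul, S.sum_κ_div_κbar hκ]
    rw [Finset.sum_add_distrib, hexcess, S.totalPower_gl hgl]
    exact (add_sub_cancel _ _).symm
  obtain ⟨g, hg, -, hpower⟩ := S.exists_power_eq hE hgl hnonneg hgl.le hsum
  exact ⟨(g, (S.totalDemand - S.Pmax) / S.κbar, fun i => g (.inl i)), hg,
    fun i => by simp [deltaP, hpower, excess], fun j => by simp [deltaP, hpower, excess],
    rfl, fun _ => rfl⟩

theorem equilibria_eq_proportionalAllocation [Nonempty F] (hE : 0 < S.E) (hgl : 0 < S.gl)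
    (hκ : ∀ i, 0 < S.κ i) (hD : S.Pmax < S.totalDemand) {a : ℝ} (ha : a ≠ 0) (b : ℝ) :
    S.equilibria a b = S.proportionalAllocation := by
  have hκbar := (S.κbar_pos hκ).ne'
  ext x
  constructor
  · rintro ⟨hnonneg, hzero⟩
    obtain ⟨hF, hI, hshared, hfilter⟩ := (S.vcsField_eq_zero_iff ha b x).1 hzero
    have hG := totalConductance_nonneg hnonneg
    have hdeficit : S.totalDeltaP (totalConductance x.1) ≠ 0 :=
      (sub_neg.2 ((S.totalPower_le_Pmax hgl hG).trans_lt hD)).ne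
    have hgl_eq : totalConductance x.1 = S.gl := by
      rw [S.deriv_totalDeltaP (by positivity)] at hshared
      exact (S.marginalPower_eq_zero_iff hE hgl hG).1
        ((mul_eq_zero.1 hshared).resolve_left hdeficit)
    have hφ : x.2.1 = (S.totalDemand - S.Pmax) / S.κbar := by
      have h : S.totalDeltaP (totalConductance x.1) = -S.κbar * x.2.1 :=
        S.totalDeltaP_of_proportional hκ (fun i => by rw [hF i]; field_simp) hI
      rw [hgl_eq, totalDeltaP, S.totalPower_gl hgl] at h
      field_simp
      linarith
    exact ⟨hnonneg, fun i => by rw [hF i, hφ]; ring, hI, hφ, hfilter⟩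
  · intro hx
    have hgl_eq := S.totalConductance_of_mem_proportionalAllocation hE hgl hκ hx
    obtain ⟨hnonneg, hF, hI, hφ, hfilter⟩ := hx
    refine ⟨hnonneg, (S.vcsField_eq_zero_iff ha b x).2
      ⟨fun i => by rw [hF, hφ]; ring, hI, ?_, hfilter⟩⟩
    rw [hgl_eq, S.deriv_totalDeltaP (by positivity),
      (S.marginalPower_eq_zero_iff hE hgl hgl.le).2 rfl, mul_zero]

theorem eventually_proportionalAllocation_stable [Nonempty F] (hE : 0 < S.E) (hgl : 0 < S.gl)
    (hκ : ∀ i, 0 < S.κ i) (hI : ∀ j : I, 0 ≤ S.P0 (.inr j)) {b : ℝ} (hb : 0 < b)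
    (hD : S.Pmax < S.totalDemand)
    (hshed : ∀ i : F, S.κ i / S.κbar * (S.totalDemand - S.Pmax) ≤ S.P0 (.inl i)) :
    ∀ᶠ a in 𝓝[>] (0 : ℝ), ∃ p, S.proportionalAllocation = {p} ∧ S.equilibria a b = {p} ∧
      IsLocallyAsymptoticallyStable (S.vcsField a b) p := by
  obtain ⟨p, hp⟩ := S.proportionalAllocation_nonempty hE hgl hκ hI hshed
  have hunique : S.proportionalAllocation = {p} :=
    (S.proportionalAllocation_subsingleton hE hgl hκ).eq_singleton_of_mem hp
  have hequilibria (a : ℝ) (ha : a ≠ 0) : S.equilibria a b = S.proportionalAllocation :=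
    S.equilibria_eq_proportionalAllocation hE hgl hκ hD ha b
  have hgl_eq := S.totalConductance_of_mem_proportionalAllocation hE hgl hκ hp
  have hstable := S.eventually_isLocallyAsymptoticallyStable hE hgl hκ hb hp.1 hgl_eq.le
    (hgl_eq ▸ S.sharedGain_gl_pos hE hgl hD) fun a ha => ((hequilibria a ha).ge hp).2
  filter_upwards [hstable, self_mem_nhdsWithin] with a ha ha0
  exact ⟨p, hunique, (hequilibria a ha0.ne').trans hunique, ha⟩

end ProportionalAllocation

section LoadSatisfaction

theorem totalDeltaP_eq_zero_of_mem_loadSatisfaction {x : State F I}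
    (hx : x ∈ S.loadSatisfaction) : S.totalDeltaP (totalConductance x.1) = 0 := by
  rw [← S.sum_deltaP]
  exact Finset.sum_eq_zero fun i _ => hx.2.1 i

theorem vcsField_eq_zero_of_mem_loadSatisfaction {x : State F I} (hx : x ∈ S.loadSatisfaction)
    {a : ℝ} (ha : a ≠ 0) (b : ℝ) : S.vcsField a b x = 0 := by
  have htotal := S.totalDeltaP_eq_zero_of_mem_loadSatisfaction hx
  obtain ⟨-, hdelta, hφ, hfilter⟩ := hx
  exact (S.vcsField_eq_zero_iff ha b x).2 ⟨fun i => by rw [hdelta, hφ, mul_zero],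
    fun j => hdelta _, by rw [htotal, zero_mul], hfilter⟩

theorem exists_mem_loadSatisfaction_mem_regionM (hE : 0 < S.E) (hgl : 0 < S.gl)
    (hP0 : ∀ i, 0 ≤ S.P0 i) (hD : S.totalDemand < S.Pmax) :
    ∃ x ∈ S.loadSatisfaction, x.1 ∈ S.regionM := by
  obtain ⟨s, hs, hpower⟩ := S.exists_totalPower_eq hgl (Finset.sum_nonneg fun i _ => hP0 i) hD
  obtain ⟨g, hg, htotal, hP⟩ := S.exists_power_eq hE hgl hP0 hs.1 hpower
  exact ⟨(g, 0, fun i => g (.inl i)), ⟨hg, fun i => sub_eq_zero.2 (hP i), rfl, fun _ => rfl⟩,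
    hg, htotal ▸ hs.2⟩

theorem totalConductance_le_of_mem_closure {g : F ⊕ I → ℝ} (hg : g ∈ closure S.regionM) :
    totalConductance g ≤ S.gl :=
  closure_minimal (t := {g | totalConductance g ≤ S.gl}) (fun _ h => h.2.le)
    (isClosed_le contDiff_totalConductance.continuous continuous_const) hg

theorem loadSatisfaction_inter_closure_subsingleton (hE : 0 < S.E) (hgl : 0 < S.gl) :
    (S.loadSatisfaction ∩ {x | x.1 ∈ closure S.regionM}).Subsingleton := by
  rintro x ⟨hx, hxM⟩ y ⟨hy, hyM⟩
  have hpower : S.totalPower (totalConductance x.1) = S.totalPower (totalConductance y.1) :=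
    (sub_left_inj (a := S.totalDemand)).1 <|
      (S.totalDeltaP_eq_zero_of_mem_loadSatisfaction hx).trans
        (S.totalDeltaP_eq_zero_of_mem_loadSatisfaction hy).symm
  obtain ⟨hx0, hxP, hxφ, hxf⟩ := hx
  obtain ⟨hy0, hyP, hyφ, hyf⟩ := hy
  have htotal : totalConductance x.1 = totalConductance y.1 :=
    (S.strictMonoOn_totalPower hE hgl).injOn
      ⟨totalConductance_nonneg hx0, S.totalConductance_le_of_mem_closure hxM⟩
      ⟨totalConductance_nonneg hy0, S.totalConductance_le_of_mem_closure hyM⟩ hpower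
  exact S.state_eq_of_deltaP_eq hE hgl hx0 htotal (fun i => (hxP i).trans (hyP i).symm)
    (hxφ.trans hyφ.symm) hxf hyf

theorem eventually_loadSatisfaction_stable [Nonempty F] (hE : 0 < S.E) (hgl : 0 < S.gl)
    (hP0 : ∀ i, 0 ≤ S.P0 i) (hκ : ∀ i, 0 < S.κ i) {b : ℝ} (hb : 0 < b)
    (hD : S.totalDemand < S.Pmax) :
    ∀ᶠ a in 𝓝[>] (0 : ℝ), ∃ p, S.loadSatisfaction ∩ {x | x.1 ∈ closure S.regionM} = {p} ∧
      p.1 ∈ S.regionM ∧ IsLocallyAsymptoticallyStable (S.vcsField a b) p := by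
  obtain ⟨p, hp, hpM⟩ := S.exists_mem_loadSatisfaction_mem_regionM hE hgl hP0 hD
  have hunique : S.loadSatisfaction ∩ {x | x.1 ∈ closure S.regionM} = {p} :=
    (S.loadSatisfaction_inter_closure_subsingleton hE hgl).eq_singleton_of_mem
      ⟨hp, subset_closure hpM⟩
  have hgain := S.sharedGain_pos_of_lt hE hgl (totalConductance_nonneg hpM.1) hpM.2
    (S.totalDeltaP_eq_zero_of_mem_loadSatisfaction hp)
  filter_upwards [S.eventually_isLocallyAsymptoticallyStable hE hgl hκ hb hpM.1 hpM.2.le hgain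
    fun a ha => S.vcsField_eq_zero_of_mem_loadSatisfaction hp ha b] with a ha
  exact ⟨p, hunique, hpM, ha⟩

end LoadSatisfaction

end StarNetwork

end StarDC

end

theorem theorem5 {F I : Type*} [Fintype F] [Fintype I] [Nonempty F]
    (S : StarDC.StarNetwork F I) (hE : 0 < S.E) (hgl : 0 < S.gl)
    (hF : ∀ i : F, 0 ≤ S.P0 (Sum.inl i)) (hI : ∀ j : I, 0 < S.P0 (Sum.inr j))
    (hκ : ∀ i : F, 0 < S.κ i) (b : ℝ) (hb : 0 < b) :
    ∃ a₀ : ℝ, 0 < a₀ ∧ ∀ a : ℝ, 0 < a → a < a₀ →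
      (S.Pmax < S.totalDemand →
        (∀ i : F, S.κ i / S.κbar * (S.totalDemand - S.Pmax) ≤ S.P0 (Sum.inl i)) →
        ∃ p : StarDC.State F I,
          S.proportionalAllocation = {p} ∧
          S.equilibria a b = {p} ∧
          StarDC.IsLocallyAsymptoticallyStable (S.vcsField a b) p) ∧
      (S.totalDemand < S.Pmax →
        ∃ p : StarDC.State F I,
          S.loadSatisfaction ∩ {x | x.1 ∈ closure S.regionM} = {p} ∧
          p.1 ∈ S.regionM ∧
          StarDC.IsLocallyAsymptoticallyStable (S.vcsField a b) p) := by
  have hI' (j : I) : 0 ≤ S.P0 (.inr j) := (hI j).le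
  have hoverload := eventually_imp_distrib_left.2 fun hD =>
    eventually_imp_distrib_left.2 fun hshed =>
      S.eventually_proportionalAllocation_stable hE hgl hκ hI' hb hD hshed
  have hfeasible := eventually_imp_distrib_left.2 fun hD =>
    S.eventually_loadSatisfaction_stable hE hgl (Sum.forall.2 ⟨hF, hI'⟩) hκ hb hD
  obtain ⟨a₀, ha₀, hstable⟩ := mem_nhdsGT_iff_exists_Ioo_subset.1 (hoverload.and hfeasible)
  exact ⟨a₀, ha₀, fun a ha haa₀ => hstable ⟨ha, haa₀⟩⟩
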